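/- Let $\Omega\subset\mathbb{R}^2$ be a compact set whose boundary $\partial\Omega$ is a simple closed, piecewise continuously differentiable curve of length $L$, and let $\gamma$ be an arclength parameterization of $\partial\Omega$, extended $L$-periodically, that keeps the interior of $\Omega$ on its left. Write $D(p,r)$ and $C(p,r)$ for the closed disk and the circle of radius $r$ about $p$, and let $g(s,r)=\operatorname{area}(\Omega\cap D(\gamma(s),r))$. The tangent cone of $\gamma$ at $t$ is $\{\alpha\Gamma^-+\beta\Gamma^+ : \alpha,\beta\ge 0,\ \alpha+\beta>0\}$, where $\Gamma^\mp$ are the left and right limits of $\gamma'$ at $t$. Let $r>0$ and suppose that $\partial\Omega$ is tangent-cone graph-like with radius $r$: for every $t$, every $w$ in the tangent cone of $\gamma$ at $t$ and all distinct $u,v\in\partial\Omega\cap D(\gamma(t),r)$ we have $\langle w,u-v\rangle\ne 0$. Let $s$ be such that $\partial\Omega$ is tangentially graph-like at $\gamma(s)$ with radius $r$: $\gamma'(s)$ exists and $\langle \gamma'(s),u-v\rangle\neq 0$ for all distinct $u,v\in\partial\Omega\cap D(\gamma(s),r)$. Use the positively oriented Cartesian coordinates with origin $\gamma(s)$ and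 positive $x$-axis in the direction $\gamma'(s)$. Then $\partial\Omega$ meets $C(\gamma(s),r)$ in exactly two points, one on the right, at polar angle $\theta_1\in(-\frac{\pi}{2},\frac{\pi}{2})$, and one on the left, at polar angle $\theta_2\in(\frac{\pi}{2},\frac{3\pi}{2})$; the partial derivative $\frac{\partial g}{\partial r}(s,r)$ exists, and $$\frac{\partial g}{\partial r}(s,r)=r(\theta_2-\theta_1).$$ Moreover $C(\gamma(s),r)\cap\Omega$ is the arc of the circle formed by the points with polar angle in $[\theta_1,\theta_2]$, and its length (one-dimensional Hausdorff measure) equals $r(\theta_2-\theta_1)$. -/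

import Mathlib

/-! The plane `ℝ²` is `ℂ`: Euclidean distance `‖z - w‖`, Euclidean inner product `inner ℝ z w`,
Lebesgue measure `volume`; multiplication by `Complex.I` is the counterclockwise quarter turn. -/

namespace AreaInvariant

/-- `γ`, restricted to `[0, L]`, is piecewise continuously differentiable: on each closed piece of
some finite partition `0 = t₀ < t₁ < ⋯ < tₙ = L` it is `C¹` up to the end points. -/
def PiecewiseC1 (L : ℝ) (γ : ℝ → ℂ) : Prop :=
  ∃ (n : ℕ) (t : Fin (n + 1) → ℝ), StrictMono t ∧ t 0 = 0 ∧ t (Fin.last n) = L ∧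
    ∀ i : Fin n, ContDiffOn ℝ 1 γ (Set.Icc (t i.castSucc) (t i.succ))

/-- `Ω` is a compact set whose boundary is a simple closed, piecewise `C¹` curve of length `L`, and
`γ` is an arclength parameterization of that boundary (extended to `ℝ` with period `L`, so that the
parameter `0` is not special) which keeps the interior of `Ω` on its left. -/
structure IsBoundaryParam (Ω : Set ℂ) (L : ℝ) (γ : ℝ → ℂ) : Prop where
  isCompact : IsCompact Ω
  length_pos : 0 < L
  continuous : Continuous γ
  periodic : Function.Periodic γ L
  injOn : Set.InjOn γ (Set.Ico 0 L)
  range_eq : Set.range γ = frontier Ω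
  piecewiseC1 : PiecewiseC1 L γ
  unit_speed : ∀ t, DifferentiableAt ℝ γ t → ‖deriv γ t‖ = 1
  interior_left : ∀ t, DifferentiableAt ℝ γ t →
    ∀ᶠ ε : ℝ in nhdsWithin 0 (Set.Ioi 0), γ t + ε * (Complex.I * deriv γ t) ∈ interior Ω

/-- The tangent cone of `γ` at `s`: all `α Γ⁻ + β Γ⁺` with `α, β ≥ 0`, `α + β > 0`, where `Γ⁻` and
`Γ⁺` are the left and right limits of `γ'` at `s`. -/
def tangentCone (γ : ℝ → ℂ) (s : ℝ) : Set ℂ :=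
  {w | ∃ (Γm Γp : ℂ) (α β : ℝ),
    Filter.Tendsto (deriv γ) (nhdsWithin s (Set.Iio s)) (nhds Γm) ∧
    Filter.Tendsto (deriv γ) (nhdsWithin s (Set.Ioi s)) (nhds Γp) ∧
    0 ≤ α ∧ 0 ≤ β ∧ 0 < α + β ∧ w = α * Γm + β * Γp}

/-- The part of the boundary of `Ω` in the closed disk of radius `r` about `p` is a graph over the
axis with direction `w`: distinct points of it have distinct coordinates along `w`. -/
def GraphLikeAlong (Ω : Set ℂ) (p : ℂ) (r : ℝ) (w : ℂ) : Prop :=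
  ∀ u ∈ frontier Ω ∩ Metric.closedBall p r, ∀ v ∈ frontier Ω ∩ Metric.closedBall p r,
    u ≠ v → inner ℝ w (u - v) ≠ 0

/-- The boundary is tangent-cone graph-like at `γ s` with radius `r`. -/
def TCGLAt (Ω : Set ℂ) (γ : ℝ → ℂ) (r s : ℝ) : Prop :=
  ∀ w ∈ tangentCone γ s, GraphLikeAlong Ω (γ s) r w

/-- The boundary is tangent-cone graph-like for radius `r`, i.e. at each of its points. -/
def TCGL (Ω : Set ℂ) (γ : ℝ → ℂ) (r : ℝ) : Prop :=
  ∀ s, TCGLAt Ω γ r s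

/-- The boundary is tangentially graph-like at `γ s` with radius `r`: it has a tangent there
(`γ s` is not a corner) and is a graph in the disk over the tangent direction. -/
def TGLAt (Ω : Set ℂ) (γ : ℝ → ℂ) (r s : ℝ) : Prop :=
  DifferentiableAt ℝ γ s ∧ GraphLikeAlong Ω (γ s) r (deriv γ s)

/-- The integral area invariant `g(s, r)`: the area of the part of `Ω` in the closed disk of radius
`r` about `γ s`. -/
noncomputable def g (Ω : Set ℂ) (γ : ℝ → ℂ) (s r : ℝ) : ℝ :=
  (MeasureTheory.volume (Ω ∩ Metric.closedBall (γ s) r)).toReal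

/-- The point of the circle of radius `r` about `γ s` at angle `θ`, in the coordinate system with
origin `γ s` and positive `x`-axis in the direction `γ' s` (the interior of `Ω` is then "up"). -/
noncomputable def circlePoint (γ : ℝ → ℂ) (s r θ : ℝ) : ℂ :=
  γ s + r * deriv γ s * Complex.exp (θ * Complex.I)

/-- `θ₁` and `θ₂` are the angles, in the coordinate system at `γ s`, of the right and of the left
point in which the boundary of `Ω` meets the circle of radius `r` about `γ s`. -/
def AreCrossingAngles (Ω : Set ℂ) (γ : ℝ → ℂ) (s r θ₁ θ₂ : ℝ) : Prop :=
  θ₁ ∈ Set.Ioo (-(Real.pi / 2)) (Real.pi / 2) ∧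
  θ₂ ∈ Set.Ioo (Real.pi / 2) (3 * Real.pi / 2) ∧
  frontier Ω ∩ Metric.sphere (γ s) r = {circlePoint γ s r θ₁, circlePoint γ s r θ₂}

end AreaInvariant

/-!
The part of `∂Ω` in the disk of radius `r` about `γ s` is a graph over the tangent line, and the
argument separates what happens to the curve from what happens to the area.

*Crossings* (`AreaInvariant.exists_areCrossingAngles`). Let `f t = ‖γ t - γ s‖²`. Wherever
`0 < f t ≤ r²`, the hypothesis on the tangent cone at `γ t`, applied to the two points `γ t` and
`γ s`, says that no vector of the cone is orthogonal to `γ t - γ s`. The cone is convex, so both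
one-sided derivatives of `f` have the same strict sign and `f` has no local extremum at `t`. Hence
over one period `f` increases up to the value `r²`, stays above it, and decreases from it to `0`
(`exists_crossings_of_no_isLocalExtr`), which gives exactly two crossings. On the two arcs inside
the disk the coordinate along `γ' s` vanishes only at `γ s`, where its derivative is `1`; so one
crossing lies on the right and the other on the left.

*Arc* (`mem_iff_of_crossing_angles`). A connected set that misses `∂Ω` lies in `Ω` or in its
complement, so each of the two open arcs between the crossings does. The inward normal at `γ s`
meets `∂Ω` in the disk only at `γ s`, and it starts in the interior of `Ω`, so the upper arc lies in
`Ω`. If the lower one did too, the whole circle would lie in `Ω`, and then the whole disk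
(`closedBall_subset_of_sphere_subset`): on the chord through a missing point, normal to the tangent,
there would be boundary points on both sides of it, against the graph property. But `γ s` is not
interior to `Ω`. No form of the Jordan curve theorem is needed.

*Derivative* (`hasDerivAt_volume_inter_closedBall`). In polar coordinates
`g(s, ρ) = ∫ u in 0..ρ, u * ℓ(u)`, where `ℓ(u)` is the measure of the set of angles at which the
circle of radius `u` lies in `Ω`. At every angle but the two crossing angles, the point of the
circle of radius `r` is off `∂Ω`, so the indicator of `Ω` is locally constant there, and `ℓ` is
continuous at `r` by dominated convergence. The fundamental theorem of calculus gives
`r * ℓ(r) = r * (θ₂ - θ₁)`; nothing has to be known about the boundary outside the disk.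
-/

open Set Filter Topology MeasureTheory
open scoped NNReal ENNReal

/-! ### Length of circular arcs -/

/-- The version of `AntilipschitzWith.le_hausdorffMeasure_image` for a map that is antilipschitz only
on the set `s`. -/
theorem hausdorffMeasure_le_mul_image_of_dist_le {X Y : Type*} [MetricSpace X] [MeasurableSpace X]
    [BorelSpace X] [MetricSpace Y] [MeasurableSpace Y] [BorelSpace Y] {f : X → Y} {s : Set X}
    {K : ℝ≥0} (h : ∀ x ∈ s, ∀ y ∈ s, dist x y ≤ K * dist (f x) (f y)) {d : ℝ} (hd : 0 ≤ d) :
    Measure.hausdorffMeasure d s ≤ (K : ℝ≥0∞) ^ d * Measure.hausdorffMeasure d (f '' s) := by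
  rcases s.eq_empty_or_nonempty with rfl | ⟨x₀, -⟩
  · simp
  have : Nonempty X := ⟨x₀⟩
  have hinj : InjOn f s := fun x hx y hy hxy => by
    have := h x hx y hy
    rw [hxy, dist_self, mul_zero] at this
    exact dist_le_zero.1 this
  have hlip : LipschitzOnWith K (Function.invFunOn f s) (f '' s) := by
    refine LipschitzOnWith.of_dist_le_mul ?_
    rintro _ ⟨x, hx, rfl⟩ _ ⟨y, hy, rfl⟩
    rw [hinj.leftInvOn_invFunOn hx, hinj.leftInvOn_invFunOn hy]
    exact h x hx y hy
  have := hlip.hausdorffMeasure_image_le hd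
  rwa [hinj.invFunOn_image Subset.rfl] at this

theorem dist_circle (p c : ℂ) (x y : ℝ) :
    dist (p + c * Complex.exp (x * Complex.I)) (p + c * Complex.exp (y * Complex.I)) =
      ‖c‖ * (2 * |Real.sin ((x - y) / 2)|) := by
  have : p + c * Complex.exp (x * Complex.I) - (p + c * Complex.exp (y * Complex.I)) =
      c * (Complex.exp (y * Complex.I) *
        (Complex.exp (Complex.I * ((x - y : ℝ) : ℂ)) - 1)) := by
    rw [mul_sub, ← Complex.exp_add]
    push_cast
    ring_nf
  rw [dist_eq_norm, this, norm_mul, norm_mul, Complex.norm_exp_ofReal_mul_I,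
    Complex.norm_exp_I_mul_ofReal_sub_one]
  simp

theorem continuous_circle (p c : ℂ) :
    Continuous fun θ : ℝ => p + c * Complex.exp (θ * Complex.I) := by
  fun_prop

theorem injOn_circle (p : ℂ) {c : ℂ} (hc : c ≠ 0) (a : ℝ) :
    InjOn (fun θ : ℝ => p + c * Complex.exp (θ * Complex.I)) (Ico a (a + 2 * Real.pi)) := by
  intro x hx y hy hxy
  have h0 : dist (p + c * Complex.exp (x * Complex.I)) (p + c * Complex.exp (y * Complex.I)) = 0 :=
    dist_eq_zero.2 hxy
  rw [dist_circle] at h0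
  have h1 : Real.sin ((x - y) / 2) = 0 := by
    simpa [hc] using h0
  have := (Real.sin_eq_zero_iff_of_lt_of_lt (by linarith [hx.1, hy.2])
    (by linarith [hx.2, hy.1])).1 h1
  linarith

/-- A chord is almost as long as its arc, when the arc is short. -/
theorem exists_mul_le_two_mul_sin_half {κ : ℝ} (hκ : κ < 1) :
    ∃ δ > 0, ∀ h : ℝ, |h| ≤ δ → κ * |h| ≤ 2 * |Real.sin (h / 2)| := by
  have h1 : HasDerivAt Real.sin 1 0 := by simpa using Real.hasDerivAt_sin 0
  have h2 : ∀ᶠ x in 𝓝 (0 : ℝ), κ * |x| ≤ |Real.sin x| := by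
    have := h1.isLittleO.def (sub_pos.2 hκ)
    filter_upwards [this] with x hx
    simp only [Real.sin_zero, sub_zero, smul_eq_mul, mul_one, Real.norm_eq_abs] at hx
    have := abs_sub_abs_le_abs_sub x (Real.sin x)
    rw [abs_sub_comm] at this
    linarith
  obtain ⟨δ, hδ, h3⟩ := Metric.eventually_nhds_iff.1 h2
  refine ⟨δ, hδ, fun h hh => ?_⟩
  have := @h3 (h / 2) (by rw [Real.dist_eq, sub_zero, abs_div, abs_two]; linarith)
  rw [abs_div, abs_two] at this
  linarith

theorem le_hausdorffMeasure_short_arc (p c : ℂ) {κ δ a b : ℝ} (hκ : 0 < κ) (hc : c ≠ 0)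
    (hδ : ∀ h : ℝ, |h| ≤ δ → κ * |h| ≤ 2 * |Real.sin (h / 2)|) (hab : b - a ≤ δ) :
    ENNReal.ofReal (κ * ‖c‖ * (b - a)) ≤
      Measure.hausdorffMeasure 1 ((fun θ : ℝ => p + c * Complex.exp (θ * Complex.I)) '' Ico a b) := by
  have hc' : 0 < ‖c‖ := norm_pos_iff.2 hc
  have hk : 0 < κ * ‖c‖ := mul_pos hκ hc'
  have h1 := hausdorffMeasure_le_mul_image_of_dist_le (d := 1)
    (f := fun θ : ℝ => p + c * Complex.exp (θ * Complex.I)) (s := Ico a b)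
    (K := (κ * ‖c‖)⁻¹.toNNReal) ?_ zero_le_one
  · rw [hausdorffMeasure_real, Real.volume_Ico, ENNReal.rpow_one] at h1
    rw [ENNReal.ofReal_mul hk.le]
    refine (mul_le_mul_right h1 _).trans_eq ?_
    rw [← mul_assoc,
      show (((κ * ‖c‖)⁻¹.toNNReal : ℝ≥0) : ℝ≥0∞) = ENNReal.ofReal (κ * ‖c‖)⁻¹ from rfl,
      ← ENNReal.ofReal_mul hk.le,
      mul_inv_cancel₀ hk.ne', ENNReal.ofReal_one, one_mul]
  · intro x hx y hy
    rw [Real.coe_toNNReal _ (by positivity), dist_circle, Real.dist_eq, inv_mul_eq_div,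
      le_div_iff₀ hk]
    have := hδ (x - y) (by rw [abs_le]; constructor <;> linarith [hx.1, hx.2, hy.1, hy.2])
    nlinarith

theorem le_hausdorffMeasure_arc_of_nat_mul (p c : ℂ) {κ δ a h : ℝ} (hκ : 0 < κ) (hc : c ≠ 0)
    (hδ : ∀ h : ℝ, |h| ≤ δ → κ * |h| ≤ 2 * |Real.sin (h / 2)|) (h0 : 0 ≤ h) (hh : h ≤ δ) (n : ℕ)
    (hn : n * h ≤ 2 * Real.pi) :
    ENNReal.ofReal (κ * ‖c‖ * (n * h)) ≤ Measure.hausdorffMeasure 1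
      ((fun θ : ℝ => p + c * Complex.exp (θ * Complex.I)) '' Ico a (a + n * h)) := by
  induction n with
  | zero => simp
  | succ n ih =>
    push_cast at hn ⊢
    have hnh : 0 ≤ n * h := by positivity
    have hinj := injOn_circle p hc a
    have hcont := continuous_circle p c
    have hsub : Ico (a + n * h) (a + (n + 1) * h) ⊆ Ico a (a + 2 * Real.pi) :=
      Ico_subset_Ico (by linarith) (by linarith)
    have hsub' : Ico a (a + n * h) ⊆ Ico a (a + 2 * Real.pi) :=
      Ico_subset_Ico le_rfl (by linarith)
    have hdisj : Disjoint (Ico a (a + n * h)) (Ico (a + n * h) (a + (n + 1) * h)) :=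
      Ico_disjoint_Ico_same
    have hmeas := measurableSet_Ico.image_of_continuousOn_injOn hcont.continuousOn (hinj.mono hsub)
    rw [← Ico_union_Ico_eq_Ico (b := a + n * h) (by linarith) (by linarith), image_union,
      measure_union (hdisj.image hinj hsub' hsub) hmeas,
      show κ * ‖c‖ * ((n + 1) * h) = κ * ‖c‖ * (n * h) + κ * ‖c‖ * (a + (n + 1) * h - (a + n * h))
        by ring, ENNReal.ofReal_add (by positivity) (by
          have : a + (n + 1) * h - (a + n * h) = h := by ring
          rw [this]; positivity)]
    exact add_le_add (ih (by linarith))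
      (le_hausdorffMeasure_short_arc p c hκ hc hδ (by linarith))

/-- The length of a circular arc is the radius times the angle. The upper bound is the Lipschitz
bound for the parametrization, the lower bound comes from cutting the arc into short pieces, on
each of which the inverse of the parametrization is almost a contraction. -/
theorem hausdorffMeasure_arc (p : ℂ) {c : ℂ} (hc : c ≠ 0) {a b : ℝ} (hab : a ≤ b)
    (hb : b - a ≤ 2 * Real.pi) :
    Measure.hausdorffMeasure 1 ((fun θ : ℝ => p + c * Complex.exp (θ * Complex.I)) '' Icc a b) =
      ENNReal.ofReal (‖c‖ * (b - a)) := by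
  apply le_antisymm
  · have hl : LipschitzWith ‖c‖₊ fun θ : ℝ => p + c * Complex.exp (θ * Complex.I) := by
      refine LipschitzWith.of_dist_le_mul fun x y => ?_
      rw [dist_circle, coe_nnnorm, Real.dist_eq]
      have : |Real.sin ((x - y) / 2)| ≤ |(x - y) / 2| := Real.abs_sin_le_abs
      rw [abs_div, abs_two] at this
      gcongr
      linarith
    refine (hl.hausdorffMeasure_image_le zero_le_one _).trans_eq ?_
    rw [hausdorffMeasure_real, Real.volume_Icc, ENNReal.rpow_one, ENNReal.ofReal_mul (norm_nonneg _),
      ofReal_norm]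
    rfl
  · have key : ∀ κ ∈ Ioo (0 : ℝ) 1, ENNReal.ofReal (κ * (‖c‖ * (b - a))) ≤
        Measure.hausdorffMeasure 1
          ((fun θ : ℝ => p + c * Complex.exp (θ * Complex.I)) '' Icc a b) := by
      intro κ hκ
      obtain ⟨δ, hδ0, hδ⟩ := exists_mul_le_two_mul_sin_half hκ.2
      obtain ⟨n, hn⟩ := exists_nat_gt ((b - a) / δ)
      have hn0 : (0 : ℝ) < n := lt_of_le_of_lt (div_nonneg (by linarith) hδ0.le) hn
      have hnh : n * ((b - a) / n) = b - a := by field_simp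
      have := le_hausdorffMeasure_arc_of_nat_mul p c (a := a) (h := (b - a) / n) hκ.1 hc hδ
        (div_nonneg (by linarith) hn0.le)
        (by rw [div_le_iff₀ hn0]; rw [div_lt_iff₀ hδ0] at hn; linarith) n (by rwa [hnh])
      rw [hnh, add_sub_cancel] at this
      rw [← mul_assoc]
      exact this.trans (measure_mono (image_mono Ico_subset_Icc_self))
    have hlim : Tendsto (fun κ : ℝ => ENNReal.ofReal (κ * (‖c‖ * (b - a)))) (𝓝[<] 1)
        (𝓝 (ENNReal.ofReal (‖c‖ * (b - a)))) := by
      refine (ENNReal.continuous_ofReal.tendsto' _ _ rfl).comp ?_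
      have : Tendsto (fun κ : ℝ => κ * (‖c‖ * (b - a))) (𝓝 1) (𝓝 (1 * (‖c‖ * (b - a)))) :=
        tendsto_id.mul_const _
      rw [one_mul] at this
      exact this.mono_left nhdsWithin_le_nhds
    exact le_of_tendsto hlim (by filter_upwards [Ioo_mem_nhdsLT one_pos] with κ hκ using key κ hκ)

/-! ### Area in polar coordinates -/

/-- The measure of the set of angles in `(-π, π)` at which the circle of radius `ρ` about the origin
lies in `K`, as the integral of the indicator of `K` along the circle. -/
noncomputable def angularMeasure (K : Set ℂ) (ρ : ℝ) : ℝ :=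
  ∫ φ in Ioo (-Real.pi) Real.pi, K.indicator (fun _ => (1 : ℝ)) (Complex.polarCoord.symm (ρ, φ))

theorem continuous_complex_polarCoord_symm : Continuous Complex.polarCoord.symm := by
  have : (Complex.polarCoord.symm : ℝ × ℝ → ℂ) =
      fun p => p.1 * (Real.cos p.2 + Real.sin p.2 * Complex.I) :=
    funext Complex.polarCoord_symm_apply
  rw [this]
  fun_prop

theorem stronglyMeasurable_indicator_polarCoord_symm {K : Set ℂ} (hK : MeasurableSet K) :
    StronglyMeasurable fun p : ℝ × ℝ =>
      K.indicator (fun _ => (1 : ℝ)) (Complex.polarCoord.symm p) :=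
  ((measurable_const.indicator hK).comp
    continuous_complex_polarCoord_symm.measurable).stronglyMeasurable

theorem stronglyMeasurable_angularMeasure {K : Set ℂ} (hK : MeasurableSet K) :
    StronglyMeasurable (angularMeasure K) :=
  (stronglyMeasurable_indicator_polarCoord_symm hK).integral_prod_right'

theorem norm_indicator_one_le {X : Type*} (K : Set X) (z : X) :
    ‖K.indicator (fun _ => (1 : ℝ)) z‖ ≤ 1 :=
  (norm_indicator_le_norm_self _ _).trans (by simp)

theorem norm_angularMeasure_le (K : Set ℂ) (ρ : ℝ) : ‖angularMeasure K ρ‖ ≤ 2 * Real.pi := by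
  refine (norm_setIntegral_le_of_norm_le_const (C := 1) (by simp) fun φ _ =>
    norm_indicator_one_le _ _).trans_eq ?_
  rw [one_mul, measureReal_def, Real.volume_Ioo, ENNReal.toReal_ofReal (by linarith [Real.pi_pos])]
  ring

theorem volume_inter_closedBall_eq_integral {K : Set ℂ} (hK : MeasurableSet K) {ρ : ℝ}
    (hρ : 0 ≤ ρ) :
    (volume (K ∩ Metric.closedBall 0 ρ)).toReal = ∫ u in (0 : ℝ)..ρ, u * angularMeasure K u := by
  have hmeas : MeasurableSet (K ∩ Metric.closedBall 0 ρ) :=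
    hK.inter Metric.isClosed_closedBall.measurableSet
  have hpt : ∀ p ∈ Ioi (0 : ℝ) ×ˢ Ioo (-Real.pi) Real.pi,
      p.1 • (K ∩ Metric.closedBall 0 ρ).indicator (fun _ => (1 : ℝ)) (Complex.polarCoord.symm p) =
      (Iic ρ ×ˢ univ).indicator (fun p : ℝ × ℝ => p.1 * K.indicator (fun _ => (1 : ℝ))
        (Complex.polarCoord.symm p)) p := by
    rintro ⟨u, φ⟩ ⟨hu, -⟩
    have hu : 0 < u := hu
    have hn : ‖Complex.polarCoord.symm (u, φ)‖ = u := by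
      rw [Complex.norm_polarCoord_symm, abs_of_pos hu]
    by_cases h1 : Complex.polarCoord.symm (u, φ) ∈ K <;> by_cases h2 : u ≤ ρ <;>
      simp only [indicator, mem_inter_iff, mem_closedBall_zero_iff, hn, h1, h2, mem_prod, mem_Iic,
        mem_univ] <;> simp
  have hfin : (Ioc 0 ρ ×ˢ Ioo (-Real.pi) Real.pi) ⊆ Ioi (0 : ℝ) ×ˢ Ioo (-Real.pi) Real.pi :=
    prod_mono Ioc_subset_Ioi_self Subset.rfl
  have hsm := stronglyMeasurable_indicator_polarCoord_symm hK
  have hint : IntegrableOn (fun p : ℝ × ℝ => p.1 * K.indicator (fun _ => (1 : ℝ))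
      (Complex.polarCoord.symm p)) (Ioc 0 ρ ×ˢ Ioo (-Real.pi) Real.pi) (volume.prod volume) := by
    refine IntegrableOn.of_bound (C := ρ) ?_
      (measurable_fst.stronglyMeasurable.mul hsm).aestronglyMeasurable ?_
    · rw [Measure.prod_prod]; simp [ENNReal.mul_lt_top_iff]
    · refine (ae_restrict_iff' (measurableSet_Ioc.prod measurableSet_Ioo)).2 (ae_of_all _ ?_)
      rintro p ⟨hp, -⟩
      rw [norm_mul, Real.norm_eq_abs, abs_of_pos hp.1]
      nlinarith [norm_indicator_one_le K (Complex.polarCoord.symm p), hp.1, hp.2]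
  calc (volume (K ∩ Metric.closedBall 0 ρ)).toReal
      = ∫ z, (K ∩ Metric.closedBall 0 ρ).indicator (fun _ => (1 : ℝ)) z := by
        rw [integral_indicator hmeas]; simp [measureReal_def]
    _ = ∫ p in Ioi (0 : ℝ) ×ˢ Ioo (-Real.pi) Real.pi, (Iic ρ ×ˢ univ).indicator
          (fun p : ℝ × ℝ => p.1 * K.indicator (fun _ => (1 : ℝ))
            (Complex.polarCoord.symm p)) p := by
        rw [← Complex.integral_comp_polarCoord_symm]
        exact setIntegral_congr_fun (measurableSet_Ioi.prod measurableSet_Ioo) hpt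
    _ = ∫ p in Ioc 0 ρ ×ˢ Ioo (-Real.pi) Real.pi, p.1 * K.indicator (fun _ => (1 : ℝ))
            (Complex.polarCoord.symm p) := by
        rw [setIntegral_indicator (measurableSet_Iic.prod MeasurableSet.univ), prod_inter_prod,
          Ioi_inter_Iic, inter_univ]
    _ = ∫ u in Ioc 0 ρ, u * angularMeasure K u := by
        rw [Measure.volume_eq_prod, setIntegral_prod _ hint]
        simp only [angularMeasure, integral_const_mul]
    _ = _ := (intervalIntegral.integral_of_le hρ).symm

/-- If the circle of radius `r` meets the boundary of `K` in a null set of angles, then the angular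
measure of `K` is continuous at `r`: at almost every angle the point of the circle lies in an open
set on which the indicator of `K` is constant. -/
theorem continuousAt_angularMeasure {K : Set ℂ} (hK : MeasurableSet K) {r : ℝ}
    (h : ∀ᵐ φ : ℝ, φ ∈ Ioo (-Real.pi) Real.pi → Complex.polarCoord.symm (r, φ) ∉ frontier K) :
    ContinuousAt (angularMeasure K) r := by
  refine continuousAt_of_dominated (bound := fun _ => 1) ?_ ?_ (by simp) ?_
  · exact Eventually.of_forall fun u =>
      ((stronglyMeasurable_indicator_polarCoord_symm hK).comp_measurable
        measurable_prodMk_left).aestronglyMeasurable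
  · exact Eventually.of_forall fun u => ae_of_all _ fun φ => norm_indicator_one_le _ _
  · refine (ae_restrict_iff' measurableSet_Ioo).2 ?_
    filter_upwards [h] with φ hφ hφm
    have hcont : ContinuousAt (fun u : ℝ => Complex.polarCoord.symm (u, φ)) r :=
      (continuous_complex_polarCoord_symm.comp
        (by fun_prop : Continuous fun u : ℝ => (u, φ))).continuousAt
    have h1 : ContinuousAt (K.indicator fun _ => (1 : ℝ)) (Complex.polarCoord.symm (r, φ)) :=
      continuousOn_const.continuousAt_indicator (hφ hφm)
    exact ContinuousAt.comp (f := fun u : ℝ => Complex.polarCoord.symm (u, φ)) h1 hcont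

theorem hasDerivAt_volume_inter_closedBall {K : Set ℂ} (hK : MeasurableSet K) {r : ℝ} (hr : 0 < r)
    (h : ∀ᵐ φ : ℝ, φ ∈ Ioo (-Real.pi) Real.pi → Complex.polarCoord.symm (r, φ) ∉ frontier K) :
    HasDerivAt (fun ρ => (volume (K ∩ Metric.closedBall 0 ρ)).toReal)
      (r * angularMeasure K r) r := by
  have hsm : StronglyMeasurable fun u => u * angularMeasure K u :=
    stronglyMeasurable_id.mul (stronglyMeasurable_angularMeasure hK)
  have hint : IntervalIntegrable (fun u => u * angularMeasure K u) volume 0 r := by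
    rw [intervalIntegrable_iff_integrableOn_Ioc_of_le hr.le]
    refine IntegrableOn.of_bound (C := r * (2 * Real.pi)) (by simp) hsm.aestronglyMeasurable ?_
    refine (ae_restrict_iff' measurableSet_Ioc).2 (ae_of_all _ fun u hu => ?_)
    rw [norm_mul, Real.norm_eq_abs, abs_of_pos hu.1]
    exact mul_le_mul hu.2 (norm_angularMeasure_le K u) (norm_nonneg _) hr.le
  refine (intervalIntegral.integral_hasDerivAt_right hint
    hsm.stronglyMeasurableAtFilter
    (continuousAt_id.mul (continuousAt_angularMeasure hK h))).congr_of_eventuallyEq ?_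
  filter_upwards [lt_mem_nhds hr] with ρ hρ
  exact volume_inter_closedBall_eq_integral hK hρ.le

/-! ### The side of the boundary on which the set lies -/

theorem IsPreconnected.subset_of_disjoint_frontier {X : Type*} [TopologicalSpace X] {S K : Set X}
    (hS : IsPreconnected S) (hd : Disjoint S (frontier K)) (hne : (S ∩ K).Nonempty) : S ⊆ K := by
  have hdisj : ∀ x ∈ S, x ∈ closure K → x ∈ interior K := fun x hx hc => by
    by_contra hi
    exact disjoint_left.1 hd hx ⟨hc, hi⟩
  refine (hS.subset_left_of_subset_union isOpen_interior isClosed_closure.isOpen_compl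
    (disjoint_compl_right.mono_left (interior_subset.trans subset_closure)) (fun x hx => ?_)
    ?_).trans interior_subset
  · by_cases hc : x ∈ closure K
    · exact Or.inl (hdisj x hx hc)
    · exact Or.inr hc
  · obtain ⟨x, hx, hxK⟩ := hne
    exact ⟨x, hx, hdisj x hx (subset_closure hxK)⟩

theorem norm_ofReal_mul_exp {r : ℝ} (hr : 0 < r) (φ : ℝ) :
    ‖(r : ℂ) * Complex.exp (φ * Complex.I)‖ = r := by
  rw [norm_mul, Complex.norm_exp_ofReal_mul_I, mul_one, Complex.norm_real, Real.norm_of_nonneg hr.le]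

theorem ofReal_mul_exp_inj {r : ℝ} (hr : 0 < r) {a x y : ℝ} (hx : x ∈ Ico a (a + 2 * Real.pi))
    (hy : y ∈ Ico a (a + 2 * Real.pi))
    (h : (r : ℂ) * Complex.exp (x * Complex.I) = r * Complex.exp (y * Complex.I)) : x = y :=
  injOn_circle 0 (Complex.ofReal_ne_zero.2 hr.ne') a hx hy (by simpa using h)

theorem ofReal_mul_exp_add_two_pi (r φ : ℝ) :
    (r : ℂ) * Complex.exp ((φ + 2 * Real.pi : ℝ) * Complex.I) =
      r * Complex.exp (φ * Complex.I) := by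
  push_cast
  rw [add_mul, Complex.exp_add, Complex.exp_two_pi_mul_I, mul_one]

/-- If the boundary of `K` meets each horizontal chord of a disk at most once and the bounding
circle lies in `K`, then so does the disk: a point outside `K` would separate two boundary points
on the chord through it. -/
theorem closedBall_subset_of_sphere_subset {K : Set ℂ} (hK : IsClosed K) {r : ℝ}
    (hgraph : InjOn Complex.im (frontier K ∩ Metric.closedBall 0 r))
    (hsph : Metric.sphere 0 r ⊆ K) : Metric.closedBall 0 r ⊆ K := by
  intro z hz
  by_contra hzK
  rw [mem_closedBall_zero_iff] at hz
  have hr : 0 ≤ r := (norm_nonneg z).trans hz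
  have hsq : z.re ^ 2 + z.im ^ 2 ≤ r ^ 2 := by
    rw [← Complex.normSq_add_mul_I z.re z.im, Complex.re_add_im, Complex.normSq_eq_norm_sq]
    gcongr
  set a := √(r ^ 2 - z.im ^ 2) with ha
  have ha2 : a ^ 2 = r ^ 2 - z.im ^ 2 := Real.sq_sqrt (by nlinarith)
  have hza : |z.re| ≤ a := Real.abs_le_sqrt (by linarith)
  rw [abs_le] at hza
  have hnorm : ∀ x : ℝ, ‖(x + z.im * Complex.I : ℂ)‖ ^ 2 = x ^ 2 + z.im ^ 2 := fun x => by
    rw [← Complex.normSq_eq_norm_sq, Complex.normSq_add_mul_I]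
  have hend : ∀ x : ℝ, x ^ 2 = a ^ 2 → (x + z.im * Complex.I : ℂ) ∈ K := fun x hx => hsph <| by
    rw [mem_sphere_zero_iff_norm, ← pow_left_inj₀ (norm_nonneg _) hr two_ne_zero, hnorm, hx, ha2]
    ring
  have hzeq : (z.re + z.im * Complex.I : ℂ) = z := Complex.re_add_im z
  have hcont : Continuous fun x : ℝ => (x + z.im * Complex.I : ℂ) := by fun_prop
  -- Between `z`, which is outside `K`, and a point of the chord in `K` lies a boundary point.
  have hfr : ∀ x₁ x₂ : ℝ, -a ≤ x₁ → x₂ ≤ a → (∃ x ∈ Icc x₁ x₂, (x + z.im * Complex.I : ℂ) ∈ K) →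
      z.re ∈ Icc x₁ x₂ → ∃ x ∈ Icc x₁ x₂, (x + z.im * Complex.I : ℂ) ∈
        frontier K ∩ Metric.closedBall 0 r := by
    rintro x₁ x₂ h1 h2 ⟨x₀, hx₀, hx₀K⟩ hre
    by_contra! hno
    refine hzK ((isPreconnected_Icc.image _ hcont.continuousOn).subset_of_disjoint_frontier
      (disjoint_left.2 ?_) ⟨_, mem_image_of_mem _ hx₀, hx₀K⟩ ⟨z.re, hre, hzeq⟩)
    rintro _ ⟨x, hx, rfl⟩ hxf
    refine hno x hx ⟨hxf, ?_⟩
    rw [mem_closedBall_zero_iff, ← pow_le_pow_iff_left₀ (norm_nonneg _) hr two_ne_zero, hnorm]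
    nlinarith [hx.1, hx.2]
  obtain ⟨x₁, hx₁, hx₁f⟩ := hfr (-a) z.re le_rfl hza.2
    ⟨-a, ⟨le_rfl, hza.1⟩, hend _ (by ring)⟩ ⟨hza.1, le_rfl⟩
  obtain ⟨x₂, hx₂, hx₂f⟩ := hfr z.re a hza.1 le_rfl ⟨a, ⟨hza.2, le_rfl⟩, hend _ rfl⟩ ⟨le_rfl, hza.2⟩
  have h12 : x₁ = x₂ := by
    have := hgraph hx₁f hx₂f (by simp)
    simpa using this
  have hx : x₁ = z.re := le_antisymm hx₁.2 (h12 ▸ hx₂.1)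
  refine hzK (hK.frontier_subset ?_)
  rw [← hzeq, ← hx]
  exact hx₁f.1

/-- The circle splits at its two boundary points into two open arcs, each of which lies in `K` or
misses `K`. The arc through `r` lies in `K`, since the radius towards `r` meets the boundary only
at the origin. The arc through `-r` misses `K`, since otherwise the whole disk would lie in `K` and
the origin would be an interior point. -/
theorem mem_iff_of_crossing_angles {K : Set ℂ} (hK : IsClosed K) {r : ℝ} (hr : 0 < r) {α β : ℝ}
    (hα : α ∈ Ioo (-Real.pi) 0) (hβ : β ∈ Ioo 0 Real.pi) (h0 : (0 : ℂ) ∈ frontier K)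
    (hgraph : InjOn Complex.im (frontier K ∩ Metric.closedBall 0 r))
    (hup : ∀ᶠ ε : ℝ in 𝓝[>] 0, (ε : ℂ) ∈ K)
    (hfr : frontier K ∩ Metric.sphere 0 r =
      {(r : ℂ) * Complex.exp (α * Complex.I), (r : ℂ) * Complex.exp (β * Complex.I)})
    {φ : ℝ} (hφ : φ ∈ Ico α (α + 2 * Real.pi)) :
    (r : ℂ) * Complex.exp (φ * Complex.I) ∈ K ↔ φ ∈ Icc α β := by
  have hcont : Continuous fun φ : ℝ => (r : ℂ) * Complex.exp (φ * Complex.I) := by fun_prop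
  have hsph : ∀ φ : ℝ, (r : ℂ) * Complex.exp (φ * Complex.I) ∈ Metric.sphere (0 : ℂ) r := fun φ =>
    mem_sphere_zero_iff_norm.2 (norm_ofReal_mul_exp hr φ)
  have hαK : (r : ℂ) * Complex.exp (α * Complex.I) ∈ K :=
    hK.frontier_subset (hfr.symm ▸ mem_insert _ _ : _ ∈ frontier K ∩ Metric.sphere 0 r).1
  have hβK : (r : ℂ) * Complex.exp (β * Complex.I) ∈ K :=
    hK.frontier_subset
      (hfr.symm ▸ mem_insert_of_mem _ rfl : _ ∈ frontier K ∩ Metric.sphere 0 r).1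
  have hcross : ∀ φ ∈ Ico α (α + 2 * Real.pi),
      (r : ℂ) * Complex.exp (φ * Complex.I) ∈ frontier K → φ = α ∨ φ = β := by
    intro φ hφ h
    have hmem : _ ∈ frontier K ∩ Metric.sphere 0 r := ⟨h, hsph φ⟩
    rw [hfr] at hmem
    exact hmem.imp (ofReal_mul_exp_inj hr hφ ⟨le_rfl, by linarith [Real.pi_pos]⟩)
      (ofReal_mul_exp_inj hr hφ ⟨by linarith [hα.2, hβ.1], by linarith [hα.1, hβ.2]⟩)
  have hpos : ∀ x ∈ Ioc 0 r, (x : ℂ) ∉ frontier K := by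
    intro x hx hxf
    have hx0 : (x : ℂ) = 0 := hgraph ⟨hxf, by
      rw [mem_closedBall_zero_iff, Complex.norm_real, Real.norm_of_nonneg hx.1.le]; exact hx.2⟩
      ⟨h0, by simpa using hr.le⟩ (by simp)
    exact hx.1.ne' (by exact_mod_cast hx0)
  have hrK : (r : ℂ) ∈ K := by
    obtain ⟨ε, hεK, hε0, hεr⟩ := (hup.and (Ioo_mem_nhdsGT hr)).exists
    refine (isPreconnected_Ioc.image (fun x : ℝ => (x : ℂ))
      Complex.continuous_ofReal.continuousOn).subset_of_disjoint_frontier (disjoint_left.2 ?_)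
      ⟨ε, mem_image_of_mem _ ⟨hε0, hεr.le⟩, hεK⟩ (mem_image_of_mem _ ⟨hr, le_rfl⟩)
    rintro _ ⟨x, hx, rfl⟩
    exact hpos x hx
  have hupper : ∀ φ ∈ Ioo α β, (r : ℂ) * Complex.exp (φ * Complex.I) ∈ K := fun φ hφ => by
    refine (isPreconnected_Ioo.image _ hcont.continuousOn).subset_of_disjoint_frontier
      (disjoint_left.2 ?_) ⟨r, ⟨0, ⟨hα.2, hβ.1⟩, by simp⟩, hrK⟩ (mem_image_of_mem _ hφ)
    rintro _ ⟨ψ, hψ, rfl⟩ hf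
    rcases hcross ψ ⟨hψ.1.le, by linarith [hψ.2, hα.1, hβ.2]⟩ hf with h | h
    · exact hψ.1.ne' h
    · exact hψ.2.ne h
  have hlower : ∀ φ ∈ Ioo β (α + 2 * Real.pi), (r : ℂ) * Complex.exp (φ * Complex.I) ∈ K →
      ∀ ψ ∈ Ioo β (α + 2 * Real.pi), (r : ℂ) * Complex.exp (ψ * Complex.I) ∈ K :=
    fun φ hφ hφK ψ hψ => by
    refine (isPreconnected_Ioo.image _ hcont.continuousOn).subset_of_disjoint_frontier
      (disjoint_left.2 ?_) ⟨_, mem_image_of_mem _ hφ, hφK⟩ (mem_image_of_mem _ hψ)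
    rintro _ ⟨x, hx, rfl⟩ hf
    rcases hcross x ⟨by linarith [hx.1, hα.2, hβ.1], hx.2⟩ hf with h | h
    · linarith [hx.1, hα.2, hβ.1]
    · exact hx.1.ne' h
  refine ⟨fun hφK => ⟨hφ.1, ?_⟩, fun h => ?_⟩
  · by_contra! hβφ
    have hall : ∀ ψ ∈ Ico α (α + 2 * Real.pi), (r : ℂ) * Complex.exp (ψ * Complex.I) ∈ K := by
      intro ψ hψ
      rcases hψ.1.eq_or_lt with rfl | h1
      · exact hαK
      rcases lt_trichotomy ψ β with h2 | rfl | h2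
      · exact hupper ψ ⟨h1, h2⟩
      · exact hβK
      · exact hlower φ ⟨hβφ, hφ.2⟩ hφK ψ ⟨h2, hψ.2⟩
    have hsphK : Metric.sphere (0 : ℂ) r ⊆ K := by
      intro z hz
      rw [mem_sphere_zero_iff_norm] at hz
      have hz' : (r : ℂ) * Complex.exp (Complex.arg z * Complex.I) = z := by
        rw [← hz]; exact Complex.norm_mul_exp_arg_mul_I z
      rw [← hz']
      rcases le_or_gt α z.arg with h1 | h1
      · exact hall _ ⟨h1, by linarith [Complex.arg_le_pi z, hα.1]⟩
      · rw [← ofReal_mul_exp_add_two_pi]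
        exact hall _ ⟨by linarith [Complex.neg_pi_lt_arg z, hα.2, Real.pi_pos], by linarith⟩
    refine h0.2 (mem_interior_iff_mem_nhds.2 (mem_of_superset (Metric.closedBall_mem_nhds 0 hr)
      (closedBall_subset_of_sphere_subset hK hgraph hsphK)))
  · rcases h.1.eq_or_lt with rfl | h1
    · exact hαK
    rcases h.2.eq_or_lt with rfl | h2
    · exact hβK
    · exact hupper φ ⟨h1, h2⟩

theorem angularMeasure_of_crossing_angles {K : Set ℂ} (hK : IsClosed K) {r : ℝ} (hr : 0 < r)
    {α β : ℝ}
    (hα : α ∈ Ioo (-Real.pi) 0) (hβ : β ∈ Ioo 0 Real.pi) (h0 : (0 : ℂ) ∈ frontier K)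
    (hgraph : InjOn Complex.im (frontier K ∩ Metric.closedBall 0 r))
    (hup : ∀ᶠ ε : ℝ in 𝓝[>] 0, (ε : ℂ) ∈ K)
    (hfr : frontier K ∩ Metric.sphere 0 r =
      {(r : ℂ) * Complex.exp (α * Complex.I), (r : ℂ) * Complex.exp (β * Complex.I)}) :
    angularMeasure K r = β - α := by
  have hpol : ∀ φ : ℝ, Complex.polarCoord.symm (r, φ) = r * Complex.exp (φ * Complex.I) :=
    fun φ => by
    rw [Complex.polarCoord_symm_apply, Complex.exp_mul_I, Complex.ofReal_cos, Complex.ofReal_sin]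
  have hmem : ∀ φ ∈ Ioo (-Real.pi) Real.pi,
      (Complex.polarCoord.symm (r, φ) ∈ K ↔ φ ∈ Icc α β) := by
    intro φ hφ
    rw [hpol]
    rcases le_or_gt α φ with h1 | h1
    · exact mem_iff_of_crossing_angles hK hr hα hβ h0 hgraph hup hfr
        ⟨h1, by linarith [hφ.2, hα.1]⟩
    · rw [← ofReal_mul_exp_add_two_pi, mem_iff_of_crossing_angles hK hr hα hβ h0 hgraph hup hfr
        ⟨by linarith [hφ.1, hα.2, Real.pi_pos], by linarith⟩]
      exact iff_of_false (fun h => by linarith [h.2, hφ.1, hβ.2]) (fun h => h1.not_ge h.1)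
  have hpt : ∀ φ ∈ Ioo (-Real.pi) Real.pi,
      K.indicator (fun _ => (1 : ℝ)) (Complex.polarCoord.symm (r, φ)) =
        (Icc α β).indicator (fun _ => (1 : ℝ)) φ := fun φ hφ => by
    simp only [indicator, hmem φ hφ]
  rw [angularMeasure, setIntegral_congr_fun measurableSet_Ioo hpt,
    setIntegral_indicator measurableSet_Icc,
    inter_eq_right.2 (Icc_subset_Ioo hα.1 hβ.2)]
  simp [measureReal_def, Real.volume_Icc, (hα.2.trans hβ.1).le]

theorem hasDerivAt_volume_of_crossing_angles {K : Set ℂ} (hK : IsClosed K) {r : ℝ} (hr : 0 < r)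
    {α β : ℝ}
    (hα : α ∈ Ioo (-Real.pi) 0) (hβ : β ∈ Ioo 0 Real.pi) (h0 : (0 : ℂ) ∈ frontier K)
    (hgraph : InjOn Complex.im (frontier K ∩ Metric.closedBall 0 r))
    (hup : ∀ᶠ ε : ℝ in 𝓝[>] 0, (ε : ℂ) ∈ K)
    (hfr : frontier K ∩ Metric.sphere 0 r =
      {(r : ℂ) * Complex.exp (α * Complex.I), (r : ℂ) * Complex.exp (β * Complex.I)}) :
    HasDerivAt (fun ρ => (volume (K ∩ Metric.closedBall 0 ρ)).toReal) (r * (β - α)) r := by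
  rw [← angularMeasure_of_crossing_angles hK hr hα hβ h0 hgraph hup hfr]
  refine hasDerivAt_volume_inter_closedBall hK.measurableSet hr ?_
  have hae : ∀ᵐ φ : ℝ, φ ∉ ({α, β} : Set ℝ) :=
    measure_eq_zero_iff_ae_notMem.1 ((toFinite _).measure_zero _)
  filter_upwards [hae] with φ hφ hφm hf
  rw [Complex.polarCoord_symm_apply, Complex.ofReal_cos, Complex.ofReal_sin,
    ← Complex.exp_mul_I] at hf
  have hmem : _ ∈ frontier K ∩ Metric.sphere 0 r :=
    ⟨hf, mem_sphere_zero_iff_norm.2 (norm_ofReal_mul_exp hr φ)⟩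
  rw [hfr] at hmem
  exact hφ (hmem.imp
    (ofReal_mul_exp_inj (a := -Real.pi) hr ⟨hφm.1.le, by linarith [hφm.2]⟩
      ⟨hα.1.le, by linarith [hα.2, Real.pi_pos]⟩)
    (ofReal_mul_exp_inj (a := -Real.pi) hr ⟨hφm.1.le, by linarith [hφm.2]⟩
      ⟨by linarith [hβ.1, Real.pi_pos], by linarith [hβ.2]⟩))

theorem sphere_inter_of_crossing_angles {K : Set ℂ} (hK : IsClosed K) {r : ℝ} (hr : 0 < r)
    {α β : ℝ}
    (hα : α ∈ Ioo (-Real.pi) 0) (hβ : β ∈ Ioo 0 Real.pi) (h0 : (0 : ℂ) ∈ frontier K)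
    (hgraph : InjOn Complex.im (frontier K ∩ Metric.closedBall 0 r))
    (hup : ∀ᶠ ε : ℝ in 𝓝[>] 0, (ε : ℂ) ∈ K)
    (hfr : frontier K ∩ Metric.sphere 0 r =
      {(r : ℂ) * Complex.exp (α * Complex.I), (r : ℂ) * Complex.exp (β * Complex.I)}) :
    Metric.sphere 0 r ∩ K = (fun φ : ℝ => (r : ℂ) * Complex.exp (φ * Complex.I)) '' Icc α β := by
  have hiff := fun φ hφ => mem_iff_of_crossing_angles hK hr hα hβ h0 hgraph hup hfr (φ := φ) hφ
  apply Subset.antisymm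
  · rintro z ⟨hz, hzK⟩
    rw [mem_sphere_zero_iff_norm] at hz
    have hz' : (r : ℂ) * Complex.exp (Complex.arg z * Complex.I) = z := by
      rw [← hz]; exact Complex.norm_mul_exp_arg_mul_I z
    rw [← hz'] at hzK
    rcases le_or_gt α z.arg with h1 | h1
    · exact ⟨_, (hiff _ ⟨h1, by linarith [Complex.arg_le_pi z, hα.1]⟩).1 hzK, hz'⟩
    · rw [← ofReal_mul_exp_add_two_pi] at hzK
      exact ⟨_, (hiff _ ⟨by linarith [Complex.neg_pi_lt_arg z, hα.2, Real.pi_pos],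
        by linarith⟩).1 hzK, (ofReal_mul_exp_add_two_pi _ _).trans hz'⟩
  · rintro _ ⟨φ, hφ, rfl⟩
    exact ⟨mem_sphere_zero_iff_norm.2 (norm_ofReal_mul_exp hr φ),
      (hiff φ ⟨hφ.1, by linarith [hφ.2, hβ.2, hα.1]⟩).2 hφ⟩

/-! ### Reduction to normalized coordinates -/

/-- The isometry `z ↦ p + w z` of the plane, for a unit complex number `w`. -/
noncomputable def rigidMotion (p : ℂ) (w : Circle) : ℂ ≃ᵢ ℂ :=
  (rotation w).toIsometryEquiv.trans (IsometryEquiv.addLeft p)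

theorem rigidMotion_apply (p : ℂ) (w : Circle) (z : ℂ) : rigidMotion p w z = p + w * z := rfl

theorem measurePreserving_rigidMotion (p : ℂ) (w : Circle) :
    MeasurePreserving (rigidMotion p w) :=
  (measurePreserving_add_left volume p).comp (rotation w).measurePreserving

theorem rigidMotion_preimage_closedBall (p : ℂ) (w : Circle) (r : ℝ) :
    rigidMotion p w ⁻¹' Metric.closedBall p r = Metric.closedBall 0 r := by
  ext z
  rw [mem_preimage, Metric.mem_closedBall, mem_closedBall_zero_iff, dist_eq_norm,
    rigidMotion_apply, add_sub_cancel_left, norm_mul, Circle.norm_coe, one_mul]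

theorem rigidMotion_preimage_sphere (p : ℂ) (w : Circle) (r : ℝ) :
    rigidMotion p w ⁻¹' Metric.sphere p r = Metric.sphere 0 r := by
  ext z
  rw [mem_preimage, Metric.mem_sphere, mem_sphere_zero_iff_norm, dist_eq_norm,
    rigidMotion_apply, add_sub_cancel_left, norm_mul, Circle.norm_coe, one_mul]

namespace AreaInvariant

/-- The coordinates are normalized by moving `γ s` to the origin and the inward normal to the
positive real axis. The polar angles are thereby lowered by `π / 2`, so that both crossing angles
lie in the range `(-π, π)` of the principal argument. -/
theorem hasDerivAt_g_and_sphere_inter_eq {Ω : Set ℂ} {L : ℝ} {γ : ℝ → ℂ}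
    (hγ : IsBoundaryParam Ω L γ) {r : ℝ} (hr : 0 < r) {s : ℝ} (hTGL : TGLAt Ω γ r s) {θ₁ θ₂ : ℝ}
    (hθ : AreCrossingAngles Ω γ s r θ₁ θ₂) :
    HasDerivAt (fun ρ : ℝ => g Ω γ s ρ) (r * (θ₂ - θ₁)) r ∧
      Metric.sphere (γ s) r ∩ Ω = circlePoint γ s r '' Icc θ₁ θ₂ := by
  obtain ⟨hdiff, hgl⟩ := hTGL
  obtain ⟨⟨h11, h12⟩, ⟨h21, h22⟩, hfr⟩ := hθ
  have hd : ‖deriv γ s‖ = 1 := hγ.unit_speed s hdiff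
  obtain ⟨w, hw⟩ : ∃ w : Circle, (w : ℂ) = deriv γ s * Complex.I :=
    ⟨⟨deriv γ s * Complex.I, mem_sphere_zero_iff_norm.2 (by simp [hd])⟩, rfl⟩
  set e := rigidMotion (γ s) w with he
  have hcp : ∀ θ : ℝ, e (r * Complex.exp ((θ - Real.pi / 2 : ℝ) * Complex.I)) =
      circlePoint γ s r θ := fun θ => by
    have : Complex.exp (((Real.pi / 2 : ℝ) : ℂ) * Complex.I) = Complex.I := by
      push_cast; exact Complex.exp_pi_div_two_mul_I
    rw [he, rigidMotion_apply, hw, Complex.ofReal_sub, sub_mul, Complex.exp_sub, this, circlePoint]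
    field_simp
  have hfrK : frontier (e ⁻¹' Ω) = e ⁻¹' frontier Ω := (e.toHomeomorph.preimage_frontier Ω).symm
  have hK : IsClosed (e ⁻¹' Ω) := hγ.isCompact.isClosed.preimage e.continuous
  have hα : θ₁ - Real.pi / 2 ∈ Ioo (-Real.pi) 0 := ⟨by linarith, by linarith⟩
  have hβ : θ₂ - Real.pi / 2 ∈ Ioo 0 Real.pi := ⟨by linarith, by linarith⟩
  have h0 : (0 : ℂ) ∈ frontier (e ⁻¹' Ω) := by
    rw [hfrK, mem_preimage, he, rigidMotion_apply, mul_zero, add_zero, ← hγ.range_eq]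
    exact mem_range_self s
  have hgraph : InjOn Complex.im (frontier (e ⁻¹' Ω) ∩ Metric.closedBall 0 r) := by
    rw [hfrK, ← rigidMotion_preimage_closedBall (γ s) w, ← preimage_inter]
    intro x hx y hy hxy
    by_contra hne
    refine hgl _ hx _ hy (e.injective.ne hne) ?_
    have h1 : e x - e y = deriv γ s * (Complex.I * (x - y)) := by
      rw [he, rigidMotion_apply, rigidMotion_apply, hw]; ring
    have h2 : (Complex.I * (x - y)).re = 0 := by simp [hxy]
    rw [h1, Complex.inner, mul_right_comm, Complex.mul_conj,
      Complex.normSq_eq_norm_sq, hd]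
    simpa using h2
  have hup : ∀ᶠ ε : ℝ in 𝓝[>] 0, (ε : ℂ) ∈ e ⁻¹' Ω := by
    filter_upwards [hγ.interior_left s hdiff] with ε hε
    rw [mem_preimage, he, rigidMotion_apply, hw]
    convert interior_subset hε using 1
    ring
  have hfr' : frontier (e ⁻¹' Ω) ∩ Metric.sphere 0 r =
      {(r : ℂ) * Complex.exp ((θ₁ - Real.pi / 2 : ℝ) * Complex.I),
        (r : ℂ) * Complex.exp ((θ₂ - Real.pi / 2 : ℝ) * Complex.I)} := by
    rw [hfrK, ← rigidMotion_preimage_sphere (γ s) w, ← preimage_inter, hfr, ← hcp, ← hcp,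
      ← image_pair e, preimage_image_eq _ e.injective]
  constructor
  · have := hasDerivAt_volume_of_crossing_angles hK hr hα hβ h0 hgraph hup hfr'
    rw [sub_sub_sub_cancel_right] at this
    refine this.congr_of_eventuallyEq (Eventually.of_forall fun ρ => ?_)
    simp only [g]
    rw [← rigidMotion_preimage_closedBall (γ s) w, ← preimage_inter,
      (measurePreserving_rigidMotion (γ s) w).measure_preimage
        (hγ.isCompact.measurableSet.inter measurableSet_closedBall).nullMeasurableSet]
  · have := congrArg (fun S => e '' S)
      (sphere_inter_of_crossing_angles hK hr hα hβ h0 hgraph hup hfr')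
    simp only [← rigidMotion_preimage_sphere (γ s) w] at this
    rw [← preimage_inter, image_preimage_eq _ e.surjective, image_image] at this
    rw [this]
    ext z
    constructor
    · rintro ⟨φ, hφ, rfl⟩
      refine ⟨φ + Real.pi / 2, ⟨by linarith [hφ.1], by linarith [hφ.2]⟩, ?_⟩
      rw [← hcp, add_sub_cancel_right]
    · rintro ⟨θ, hθ, rfl⟩
      exact ⟨θ - Real.pi / 2, ⟨by linarith [hθ.1], by linarith [hθ.2]⟩, hcp θ⟩

theorem hausdorffMeasure_image_circlePoint {γ : ℝ → ℂ} {s r : ℝ} (hr : 0 < r)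
    (hd : ‖deriv γ s‖ = 1) {θ₁ θ₂ : ℝ} (h : θ₁ ≤ θ₂) (h' : θ₂ - θ₁ ≤ 2 * Real.pi) :
    Measure.hausdorffMeasure 1 (circlePoint γ s r '' Icc θ₁ θ₂) =
      ENNReal.ofReal (r * (θ₂ - θ₁)) := by
  have hc : ‖(r : ℂ) * deriv γ s‖ = r := by
    rw [norm_mul, hd, mul_one, Complex.norm_real, Real.norm_of_nonneg hr.le]
  have := hausdorffMeasure_arc (γ s) (norm_pos_iff.1 (hc.symm ▸ hr)) h h'
  rwa [hc] at this

end AreaInvariant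

/-! ### One-sided tangents of a piecewise `C¹` curve -/

theorem exists_castSucc_le_lt_succ {n : ℕ} {t : Fin (n + 1) → ℝ} {x : ℝ} (h0 : t 0 ≤ x)
    (h1 : x < t (Fin.last n)) : ∃ i : Fin n, t i.castSucc ≤ x ∧ x < t i.succ := by
  by_contra! h
  have : ∀ i, t i ≤ x := fun i => Fin.induction h0 (fun i hi => h i hi) i
  exact (this _).not_gt h1

theorem exists_castSucc_lt_le_succ {n : ℕ} {t : Fin (n + 1) → ℝ} {x : ℝ} (h0 : t 0 < x)
    (h1 : x ≤ t (Fin.last n)) : ∃ i : Fin n, t i.castSucc < x ∧ x ≤ t i.succ := by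
  by_contra! h
  have : ∀ i, t i < x := fun i => Fin.induction h0 (fun i hi => h i hi) i
  exact (this _).not_ge h1

theorem ContDiffOn.tendsto_deriv_nhdsGT {γ : ℝ → ℂ} {a b x : ℝ}
    (h : ContDiffOn ℝ 1 γ (Icc a b)) (hx : x ∈ Ico a b) :
    Tendsto (deriv γ) (𝓝[>] x) (𝓝 (derivWithin γ (Icc a b) x)) := by
  have hc := h.continuousOn_derivWithin (uniqueDiffOn_Icc (hx.1.trans_lt hx.2)) le_rfl x
    ⟨hx.1, hx.2.le⟩
  refine (hc.mono_left (nhdsWithin_le_of_mem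
    (mem_of_superset (Ioo_mem_nhdsGT hx.2) fun y hy => ⟨hx.1.trans hy.1.le, hy.2.le⟩))).congr' ?_
  filter_upwards [Ioo_mem_nhdsGT hx.2] with y hy
  exact derivWithin_of_mem_nhds (Icc_mem_nhds (hx.1.trans_lt hy.1) hy.2)

theorem ContDiffOn.tendsto_deriv_nhdsLT {γ : ℝ → ℂ} {a b x : ℝ}
    (h : ContDiffOn ℝ 1 γ (Icc a b)) (hx : x ∈ Ioc a b) :
    Tendsto (deriv γ) (𝓝[<] x) (𝓝 (derivWithin γ (Icc a b) x)) := by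
  have hc := h.continuousOn_derivWithin (uniqueDiffOn_Icc (hx.1.trans_le hx.2)) le_rfl x
    ⟨hx.1.le, hx.2⟩
  refine (hc.mono_left (nhdsWithin_le_of_mem
    (mem_of_superset (Ioo_mem_nhdsLT hx.1) fun y hy => ⟨hy.1.le, hy.2.le.trans hx.2⟩))).congr' ?_
  filter_upwards [Ioo_mem_nhdsLT hx.1] with y hy
  exact derivWithin_of_mem_nhds (Icc_mem_nhds hy.1 (hy.2.trans_le hx.2))

theorem Function.Periodic.deriv {γ : ℝ → ℂ} {L : ℝ} (h : Function.Periodic γ L) :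
    Function.Periodic (deriv γ) L := fun x => by
  rw [← deriv_comp_add_const, funext h]

namespace AreaInvariant

variable {Ω : Set ℂ} {L : ℝ} {γ : ℝ → ℂ}

/-- The parameter is shifted by a multiple of the period into `[0, L)`, so that it is not the right
end of the piece it lies in. -/
theorem IsBoundaryParam.exists_right_tangent (hγ : IsBoundaryParam Ω L γ) (x : ℝ) :
    ∃ v : ℂ, Tendsto (deriv γ) (𝓝[>] x) (𝓝 v) ∧ HasDerivWithinAt γ v (Ioi x) x := by
  obtain ⟨n, t, -, ht0, htL, hC⟩ := hγ.piecewiseC1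
  obtain ⟨k, hk, -⟩ := existsUnique_sub_zsmul_mem_Ico hγ.length_pos x 0
  rw [zero_add] at hk
  obtain ⟨i, hi1, hi2⟩ := exists_castSucc_le_lt_succ (ht0.le.trans hk.1) (hk.2.trans_eq htL.symm)
  have hshift : Tendsto (fun y => y - k • L) (𝓝[>] x) (𝓝[>] (x - k • L)) :=
    ((continuous_sub_right (k • L)).continuousWithinAt).tendsto_nhdsWithin
      fun y hy => sub_lt_sub_right (mem_Ioi.1 hy) (k • L)
  have hfun : (γ ∘ fun y => id y - k • L) = γ := funext fun y => hγ.periodic.sub_zsmul_eq k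
  refine ⟨_, (((hC i).tendsto_deriv_nhdsGT ⟨hi1, hi2⟩).comp hshift).congr
    fun y => hγ.periodic.deriv.sub_zsmul_eq k, ?_⟩
  have hd : HasDerivWithinAt γ (derivWithin γ (Icc (t i.castSucc) (t i.succ)) (x - k • L))
      (Ioi (x - k • L)) (x - k • L) :=
    (((hC i).differentiableOn one_ne_zero _ ⟨hi1, hi2.le⟩).hasDerivWithinAt).mono_of_mem_nhdsWithin
      (mem_of_superset (Ioo_mem_nhdsGT hi2) fun y hy => ⟨hi1.trans hy.1.le, hy.2.le⟩)
  have := hd.scomp x ((hasDerivWithinAt_id x (Ioi x)).sub_const (k • L))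
    (fun y hy => sub_lt_sub_right (mem_Ioi.1 hy) (k • L))
  rwa [one_smul, hfun] at this

/-- The parameter is shifted by a multiple of the period into `(0, L]`, so that it is not the left
end of the piece it lies in. -/
theorem IsBoundaryParam.exists_left_tangent (hγ : IsBoundaryParam Ω L γ) (x : ℝ) :
    ∃ v : ℂ, Tendsto (deriv γ) (𝓝[<] x) (𝓝 v) ∧ HasDerivWithinAt γ v (Iio x) x := by
  obtain ⟨n, t, -, ht0, htL, hC⟩ := hγ.piecewiseC1
  obtain ⟨k, hk, -⟩ := existsUnique_sub_zsmul_mem_Ioc hγ.length_pos x 0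
  rw [zero_add] at hk
  obtain ⟨i, hi1, hi2⟩ := exists_castSucc_lt_le_succ (ht0.trans_lt hk.1) (hk.2.trans_eq htL.symm)
  have hshift : Tendsto (fun y => y - k • L) (𝓝[<] x) (𝓝[<] (x - k • L)) :=
    ((continuous_sub_right (k • L)).continuousWithinAt).tendsto_nhdsWithin
      fun y hy => sub_lt_sub_right (mem_Iio.1 hy) (k • L)
  have hfun : (γ ∘ fun y => id y - k • L) = γ := funext fun y => hγ.periodic.sub_zsmul_eq k
  refine ⟨_, (((hC i).tendsto_deriv_nhdsLT ⟨hi1, hi2⟩).comp hshift).congr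
    fun y => hγ.periodic.deriv.sub_zsmul_eq k, ?_⟩
  have hd : HasDerivWithinAt γ (derivWithin γ (Icc (t i.castSucc) (t i.succ)) (x - k • L))
      (Iio (x - k • L)) (x - k • L) :=
    (((hC i).differentiableOn one_ne_zero _ ⟨hi1.le, hi2⟩).hasDerivWithinAt).mono_of_mem_nhdsWithin
      (mem_of_superset (Ioo_mem_nhdsLT hi1) fun y hy => ⟨hy.1.le, hy.2.le.trans hi2⟩)
  have := hd.scomp x ((hasDerivWithinAt_id x (Iio x)).sub_const (k • L))
    (fun y hy => sub_lt_sub_right (mem_Iio.1 hy) (k • L))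
  rwa [one_smul, hfun] at this

/-! ### The distance to a point of the boundary along the curve -/

/-- Where the curve is within distance `r` of `p`, a boundary point other than `p`, the distance to
`p` is strictly monotone: the two one-sided derivatives of its square have the same strict sign,
because no vector of the tangent cone is orthogonal to the direction of `p`. -/
theorem exists_one_sided_derivs_norm_sq (hγ : IsBoundaryParam Ω L γ) {r : ℝ} (hT : TCGL Ω γ r)
    {p : ℂ} (hp : p ∈ frontier Ω) {x : ℝ} (hne : γ x ≠ p) (hx : ‖γ x - p‖ ≤ r) :
    ∃ a b : ℝ, HasDerivWithinAt (fun y => ‖γ y - p‖ ^ 2) a (Iio x) x ∧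
      HasDerivWithinAt (fun y => ‖γ y - p‖ ^ 2) b (Ioi x) x ∧ 0 < a * b := by
  obtain ⟨v, hv, hv'⟩ := hγ.exists_left_tangent x
  obtain ⟨w, hw, hw'⟩ := hγ.exists_right_tangent x
  have hcone : ∀ α β : ℝ, 0 ≤ α → 0 ≤ β → 0 < α + β →
      α * inner ℝ (γ x - p) v + β * inner ℝ (γ x - p) w ≠ 0 := by
    intro α β hα hβ hαβ
    have hr : 0 ≤ r := (norm_nonneg _).trans hx
    have := hT x (α * v + β * w) ⟨v, w, α, β, hv, hw, hα, hβ, hαβ, rfl⟩ (γ x)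
      ⟨hγ.range_eq ▸ mem_range_self x, Metric.mem_closedBall_self hr⟩ p
      ⟨hp, by rwa [Metric.mem_closedBall, dist_comm, dist_eq_norm]⟩ hne
    rwa [real_inner_comm, inner_add_right, ← Complex.real_smul, ← Complex.real_smul,
      real_inner_smul_right, real_inner_smul_right] at this
  refine ⟨_, _, (hv'.sub_const p).norm_sq, (hw'.sub_const p).norm_sq, ?_⟩
  set a := inner ℝ (γ x - p) v
  set b := inner ℝ (γ x - p) w
  by_contra! hab
  have ha : a ≠ 0 := by simpa using hcone 1 0 zero_le_one le_rfl (by norm_num)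
  -- If the signs differ, the combination with weights `|b|` and `|a|` is orthogonal to `γ x - p`.
  have hab' : |b| * a + |a| * b = 0 := by
    rcases lt_or_gt_of_ne ha with h | h
    · have : 0 ≤ b := by by_contra! hb; nlinarith [mul_pos_of_neg_of_neg h hb]
      rw [abs_of_neg h, abs_of_nonneg this]; ring
    · have : b ≤ 0 := by by_contra! hb; nlinarith [mul_pos h hb]
      rw [abs_of_pos h, abs_of_nonpos this]; ring
  exact hcone |b| |a| (abs_nonneg _) (abs_nonneg _)
    (add_pos_of_nonneg_of_pos (abs_nonneg _) (abs_pos.2 ha)) hab'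

end AreaInvariant

theorem IsLocalMin.one_sided_derivs_mul_nonpos {f : ℝ → ℝ} {x a b : ℝ} (h : IsLocalMin f x)
    (ha : HasDerivWithinAt f a (Iio x) x) (hb : HasDerivWithinAt f b (Ioi x) x) : a * b ≤ 0 := by
  rw [hasDerivWithinAt_iff_tendsto_slope' (by simp)] at ha hb
  refine mul_nonpos_of_nonpos_of_nonneg (le_of_tendsto ha ?_) (ge_of_tendsto hb ?_)
  · filter_upwards [h.filter_mono nhdsWithin_le_nhds, self_mem_nhdsWithin] with y hy hyx
    rw [slope_def_field]
    exact div_nonpos_of_nonneg_of_nonpos (sub_nonneg.2 hy) (sub_nonpos.2 (le_of_lt hyx))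
  · filter_upwards [h.filter_mono nhdsWithin_le_nhds, self_mem_nhdsWithin] with y hy hyx
    rw [slope_def_field]
    exact div_nonneg (sub_nonneg.2 hy) (sub_nonneg.2 (le_of_lt hyx))

theorem IsLocalExtr.one_sided_derivs_mul_nonpos {f : ℝ → ℝ} {x a b : ℝ} (h : IsLocalExtr f x)
    (ha : HasDerivWithinAt f a (Iio x) x) (hb : HasDerivWithinAt f b (Ioi x) x) : a * b ≤ 0 := by
  rcases h with h | h
  · exact IsLocalMin.one_sided_derivs_mul_nonpos h ha hb
  · have := IsLocalMin.one_sided_derivs_mul_nonpos (IsLocalMax.neg h) ha.neg hb.neg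
    rwa [neg_mul_neg] at this

/-- A continuous function that vanishes at both ends of an interval, and has no local extremum at
interior points where its value is at most `c`, takes the value `c > 0` exactly twice. -/
theorem exists_crossings_of_no_isLocalExtr {f : ℝ → ℝ} {a b c : ℝ} (hab : a < b) (hc : 0 < c)
    (hf : ContinuousOn f (Icc a b)) (ha : f a = 0) (hb : f b = 0)
    (hpos : ∀ x ∈ Ioo a b, 0 < f x)
    (hext : ∀ x ∈ Ioo a b, f x ≤ c → ¬ IsLocalExtr f x) :
    ∃ u v, a < u ∧ u < v ∧ v < b ∧ (∀ x ∈ Icc a b, f x = c ↔ x = u ∨ x = v) ∧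
      (∀ x ∈ Icc a u, f x ≤ c) ∧ ∀ x ∈ Icc v b, f x ≤ c := by
  obtain ⟨m, hm, hmax⟩ := isCompact_Icc.exists_isMaxOn (nonempty_Icc.2 hab.le) hf
  have hmm : m ∈ Ioo a b := by
    have h1 : f ((a + b) / 2) ≤ f m := hmax ⟨by linarith, by linarith⟩
    have h2 := hpos ((a + b) / 2) ⟨by linarith, by linarith⟩
    exact ⟨hm.1.lt_of_ne (by rintro rfl; linarith), hm.2.lt_of_ne (by rintro rfl; linarith)⟩
  have hmc : c < f m := by
    by_contra! h
    exact hext m hmm h (Or.inr (hmax.isLocalMax (Icc_mem_nhds hmm.1 hmm.2)))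
  -- A value at most `c` exceeds the value at one of the end points of any interval around it, since
  -- the minimum over the interval cannot be attained at an interior point.
  have hmin : ∀ x y z, a ≤ x → z ≤ b → x < y → y < z → f y ≤ c → f x < f y ∨ f z < f y := by
    intro x y z hx hz hxy hyz hyc
    by_contra! h
    obtain ⟨k, hk, hkmin⟩ := isCompact_Icc.exists_isMinOn (nonempty_Icc.2 (hxy.trans hyz).le)
      (hf.mono (Icc_subset_Icc hx hz))
    have hky : f k ≤ f y := hkmin ⟨hxy.le, hyz.le⟩
    by_cases hk' : k = x ∨ k = z
    · have : IsMinOn f (Icc x z) y := by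
        intro w hw
        have h1 : f k ≤ f w := hkmin hw
        have h2 : f y ≤ f k := by rcases hk' with rfl | rfl; exacts [h.1, h.2]
        exact h2.trans h1
      exact hext y ⟨by linarith, by linarith⟩ hyc
        (Or.inl (this.isLocalMin (Icc_mem_nhds hxy hyz)))
    · push Not at hk'
      have h1 : x < k := hk.1.lt_of_ne' hk'.1
      have h2 : k < z := hk.2.lt_of_ne hk'.2
      exact hext k ⟨by linarith, by linarith⟩ (hky.trans hyc)
        (Or.inl (hkmin.isLocalMin (Icc_mem_nhds h1 h2)))
  have hinc : ∀ x y, a ≤ x → x < y → y ≤ m → f y ≤ c → f x < f y := fun x y hx hxy hy hyc => by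
    rcases hy.eq_or_lt with rfl | hy
    · exact absurd hmc hyc.not_gt
    · exact (hmin x y m hx hmm.2.le hxy hy hyc).resolve_right fun h => by linarith
  have hdec : ∀ x y, m ≤ x → x < y → y ≤ b → f x ≤ c → f y < f x := fun x y hx hxy hy hxc => by
    rcases hx.eq_or_lt with rfl | hx
    · exact absurd hmc hxc.not_gt
    · exact (hmin m x y hmm.1.le hy hx hxy hxc).resolve_left fun h => by linarith
  obtain ⟨u, hu, hfu⟩ := intermediate_value_Ioo hmm.1.le (hf.mono (Icc_subset_Icc le_rfl hmm.2.le))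
    (show c ∈ Ioo (f a) (f m) from ⟨by linarith, hmc⟩)
  obtain ⟨v, hv, hfv⟩ := intermediate_value_Ioo' hmm.2.le (hf.mono (Icc_subset_Icc hmm.1.le le_rfl))
    (show c ∈ Ioo (f b) (f m) from ⟨by linarith, hmc⟩)
  refine ⟨u, v, hu.1, hu.2.trans hv.1, hv.2, fun x hx => ⟨fun hxc => ?_, ?_⟩, fun x hx => ?_,
    fun x hx => ?_⟩
  · rcases le_total x m with h | h
    · left
      rcases lt_trichotomy x u with h' | h' | h'
      · linarith [hinc x u hx.1 h' hu.2.le hfu.le]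
      · exact h'
      · linarith [hinc u x hu.1.le h' h hxc.le]
    · right
      rcases lt_trichotomy x v with h' | h' | h'
      · linarith [hdec x v h h' hv.2.le hxc.le]
      · exact h'
      · linarith [hdec v x hv.1.le h' hx.2 hfv.le]
  · rintro (rfl | rfl)
    exacts [hfu, hfv]
  · rcases hx.2.eq_or_lt with rfl | h
    · exact hfu.le
    · linarith [hinc x u hx.1 h hu.2.le hfu.le]
  · rcases hx.1.eq_or_lt with rfl | h
    · exact hfv.le
    · linarith [hdec v x hv.1.le h hx.2 hfv.le]

theorem pos_right_of_hasDerivAt_pos {f : ℝ → ℝ} {a b k : ℝ} (hab : a < b)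
    (hf : ContinuousOn f (Icc a b)) (ha : f a = 0) (hd : HasDerivAt f k a) (hk : 0 < k)
    (hne : ∀ x ∈ Ioc a b, f x ≠ 0) : 0 < f b := by
  by_contra! hb
  have hs := (hasDerivWithinAt_iff_tendsto_slope' (by simp)).1 (hd.hasDerivWithinAt (s := Ioi a))
  obtain ⟨x, hx, hxa, hxb⟩ := ((hs.eventually_const_lt hk).and (Ioo_mem_nhdsGT hab)).exists
  rw [slope_def_field, ha, sub_zero] at hx
  have hfx : 0 < f x := by
    have := mul_pos hx (sub_pos.2 hxa)
    rwa [div_mul_cancel₀ _ (sub_pos.2 hxa).ne'] at this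
  obtain ⟨y, hy, hfy⟩ := intermediate_value_Icc' hxb.le (hf.mono (Icc_subset_Icc hxa.le le_rfl))
    (show (0 : ℝ) ∈ Icc (f b) (f x) from ⟨hb, hfx.le⟩)
  exact hne y ⟨hxa.trans_le hy.1, hy.2⟩ hfy

/-! ### The crossing angles -/

namespace AreaInvariant

variable {Ω : Set ℂ} {L : ℝ} {γ : ℝ → ℂ}

theorem IsBoundaryParam.injOn_Ico (hγ : IsBoundaryParam Ω L γ) (a : ℝ) :
    InjOn γ (Ico a (a + L)) := by
  intro x hx y hy hxy
  obtain ⟨j, hj, -⟩ := existsUnique_sub_zsmul_mem_Ico hγ.length_pos x 0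
  obtain ⟨k, hk, -⟩ := existsUnique_sub_zsmul_mem_Ico hγ.length_pos y 0
  rw [zero_add] at hj hk
  have h1 := hγ.injOn hj hk
    (by rw [hγ.periodic.sub_zsmul_eq, hγ.periodic.sub_zsmul_eq, hxy])
  have h2 := (existsUnique_sub_zsmul_mem_Ico hγ.length_pos x a).unique (y₁ := 0) (y₂ := j - k)
    (by simpa using hx) (by
      have : x - (j - k) • L = y := by rw [sub_smul]; linarith
      rw [this]; exact hy)
  rw [sub_eq_zero.1 h2.symm] at h1
  exact sub_left_injective h1

theorem exists_circlePoint_eq {s r : ℝ} (hd : ‖deriv γ s‖ = 1) {q : ℂ} (hq : ‖q - γ s‖ = r)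
    (hpos : 0 < inner ℝ (deriv γ s) (q - γ s)) :
    ∃ θ ∈ Ioo (-(Real.pi / 2)) (Real.pi / 2), circlePoint γ s r θ = q := by
  set z := (q - γ s) * (starRingEnd ℂ) (deriv γ s) with hz
  have hzr : ‖z‖ = r := by rw [hz, norm_mul, RCLike.norm_conj, hd, mul_one, hq]
  refine ⟨z.arg, abs_lt.1 (Complex.abs_arg_lt_pi_div_two_iff.2 (Or.inl ?_)), ?_⟩
  · rwa [hz, ← Complex.inner]
  · have h1 := Complex.norm_mul_exp_arg_mul_I z
    rw [hzr] at h1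
    rw [circlePoint, mul_right_comm, h1, hz, mul_assoc, mul_comm ((starRingEnd ℂ) _),
      Complex.mul_conj, Complex.normSq_eq_norm_sq, hd]
    simp

theorem circlePoint_add_pi (s r θ : ℝ) :
    circlePoint γ s r (θ + Real.pi) - γ s = -(circlePoint γ s r θ - γ s) := by
  simp only [circlePoint]
  push_cast
  rw [add_mul, Complex.exp_add, Complex.exp_pi_mul_I]
  ring

/-- The curve leaves the disk once and comes back once. On the way out it moves to the right and on
the way back it comes from the left, because the coordinate along the tangent does not vanish on
these two arcs and has derivative `1` at `s`. -/
theorem exists_areCrossingAngles (hγ : IsBoundaryParam Ω L γ) {r : ℝ} (hr : 0 < r)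
    (hT : TCGL Ω γ r) {s : ℝ} (hTGL : TGLAt Ω γ r s) :
    ∃ θ₁ θ₂ : ℝ, AreCrossingAngles Ω γ s r θ₁ θ₂ := by
  obtain ⟨hdiff, hgl⟩ := hTGL
  have hd : ‖deriv γ s‖ = 1 := hγ.unit_speed s hdiff
  have hL := hγ.length_pos
  have hmemF : ∀ t, γ t ∈ frontier Ω := fun t => hγ.range_eq ▸ mem_range_self t
  have hne : ∀ t ∈ Ioo s (s + L), γ t ≠ γ s := fun t ht h =>
    ht.1.ne' (hγ.injOn_Ico s ⟨ht.1.le, ht.2⟩ ⟨le_rfl, by linarith⟩ h)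
  have hγL : γ (s + L) = γ s := hγ.periodic s
  have hsq : ∀ t, ‖γ t - γ s‖ ^ 2 ≤ r ^ 2 ↔ ‖γ t - γ s‖ ≤ r := fun t =>
    pow_le_pow_iff_left₀ (norm_nonneg _) hr.le two_ne_zero
  obtain ⟨u, v, hu, huv, hv, hiff, hleu, hlev⟩ := exists_crossings_of_no_isLocalExtr
    (f := fun t => ‖γ t - γ s‖ ^ 2) (a := s) (b := s + L) (c := r ^ 2) (by linarith) (by positivity)
    (((hγ.continuous.sub continuous_const).norm.pow 2).continuousOn) (by simp) (by simp [hγL])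
    (fun t ht => by
      have := norm_pos_iff.2 (sub_ne_zero.2 (hne t ht))
      positivity)
    (fun t ht htr hext => by
      obtain ⟨a, b, ha, hb, hab⟩ := exists_one_sided_derivs_norm_sq hγ hT (hmemF s) (hne t ht)
        ((hsq t).1 htr)
      exact (hext.one_sided_derivs_mul_nonpos ha hb).not_gt hab)
  have hsphere : frontier Ω ∩ Metric.sphere (γ s) r = {γ u, γ v} := by
    have heq : ∀ t, γ t ∈ Metric.sphere (γ s) r ↔ ‖γ t - γ s‖ ^ 2 = r ^ 2 := fun t => by
      rw [mem_sphere_iff_norm, pow_left_inj₀ (norm_nonneg _) hr.le two_ne_zero]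
    ext z
    constructor
    · rintro ⟨hz, hzr⟩
      rw [← hγ.range_eq] at hz
      obtain ⟨t, rfl⟩ := hz
      obtain ⟨k, hk, -⟩ := existsUnique_sub_zsmul_mem_Ico hL t s
      rw [← hγ.periodic.sub_zsmul_eq k (x := t)] at hzr ⊢
      rcases (hiff _ ⟨hk.1, hk.2.le⟩).1 ((heq _).1 hzr) with h | h
      · exact Or.inl (by rw [h])
      · exact Or.inr (by rw [h]; rfl)
    · rintro (rfl | rfl)
      · exact ⟨hmemF u, (heq u).2 ((hiff u ⟨hu.le, by linarith⟩).2 (Or.inl rfl))⟩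
      · exact ⟨hmemF v, (heq v).2 ((hiff v ⟨by linarith, hv.le⟩).2 (Or.inr rfl))⟩
  have hnorm : ∀ t, γ t ∈ ({γ u, γ v} : Set ℂ) → ‖γ t - γ s‖ = r := fun t ht =>
    mem_sphere_iff_norm.1 (hsphere.symm ▸ ht : γ t ∈ frontier Ω ∩ Metric.sphere (γ s) r).2
  have hX : ∀ t ∈ Ioo s (s + L), ‖γ t - γ s‖ ≤ r → inner ℝ (deriv γ s) (γ t - γ s) ≠ 0 :=
    fun t ht htr => hgl _ ⟨hmemF t, by rwa [mem_closedBall_iff_norm]⟩ _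
      ⟨hmemF s, Metric.mem_closedBall_self hr.le⟩ (hne t ht)
  have hXc : Continuous fun t => inner ℝ (deriv γ s) (γ t - γ s) :=
    continuous_const.inner (hγ.continuous.sub continuous_const)
  have hXd : HasDerivAt (fun t => inner ℝ (deriv γ s) (γ t - γ s)) 1 s := by
    have := (hasDerivAt_const s (deriv γ s)).inner ℝ (hdiff.hasDerivAt.sub_const (γ s))
    simpa [real_inner_self_eq_norm_sq, hd] using this
  have hposu : 0 < inner ℝ (deriv γ s) (γ u - γ s) :=
    pos_right_of_hasDerivAt_pos (f := fun t => inner ℝ (deriv γ s) (γ t - γ s)) hu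
      hXc.continuousOn (by simp) hXd one_pos fun t ht =>
      hX t ⟨ht.1, by linarith [ht.2]⟩ ((hsq t).1 (hleu t ⟨ht.1.le, ht.2⟩))
  -- The arc that comes back is traversed backwards from `γ s`.
  have hnegv : 0 < -inner ℝ (deriv γ s) (γ v - γ s) := by
    have hperiod : ∀ τ, γ (s - τ) = γ (s + L - τ) := fun τ => by
      rw [← hγ.periodic (s - τ)]; ring_nf
    have := pos_right_of_hasDerivAt_pos (f := fun τ => -inner ℝ (deriv γ s) (γ (s - τ) - γ s))
      (a := 0) (b := s + L - v) (k := 1) (by linarith)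
      (hXc.comp (continuous_sub_left s)).neg.continuousOn (by simp) (by
        have h1 : HasDerivAt (fun τ : ℝ => s - τ) (-1) 0 := by
          simpa using (hasDerivAt_id (0 : ℝ)).const_sub s
        have h2 := (HasDerivAt.comp (0 : ℝ) (h₂ := fun t => inner ℝ (deriv γ s) (γ t - γ s))
          (by rw [sub_zero]; exact hXd) h1).neg
        exact h2.congr_deriv (by norm_num)) one_pos (fun τ hτ => by
        simp only [hperiod]
        refine neg_ne_zero.2 (hX _ ⟨by linarith [hτ.2], by linarith [hτ.1]⟩
          ((hsq _).1 (hlev _ ⟨by linarith [hτ.2], by linarith [hτ.1]⟩))))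
    simpa only [hperiod, sub_sub_cancel] using this
  obtain ⟨θ₁, hθ₁, h1⟩ := exists_circlePoint_eq hd (hnorm u (Or.inl rfl)) hposu
  -- The angle of the left point is found from its mirror image in `γ s`.
  obtain ⟨θ₂, hθ₂, h2⟩ := exists_circlePoint_eq (s := s) (q := γ s - (γ v - γ s)) (r := r) hd
    (by rw [sub_sub_cancel_left, norm_neg]; exact hnorm v (Or.inr rfl))
    (by rw [sub_sub_cancel_left, inner_neg_right]; exact hnegv)
  have h3 : circlePoint γ s r (θ₂ + Real.pi) = γ v := by
    have := circlePoint_add_pi (γ := γ) s r θ₂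
    rw [h2, sub_sub_cancel_left, neg_neg] at this
    exact sub_left_injective this
  exact ⟨θ₁, θ₂ + Real.pi, hθ₁, ⟨by linarith [hθ₂.1], by linarith [hθ₂.2]⟩,
    by rw [h1, h3, hsphere]⟩

end AreaInvariant

/-! ### The derivative of the area invariant -/

theorem mainTheorem6 (Ω : Set ℂ) (L : ℝ) (γ : ℝ → ℂ)
    (hγ : AreaInvariant.IsBoundaryParam Ω L γ)
    (r : ℝ) (hr : 0 < r) (hTCGL : AreaInvariant.TCGL Ω γ r)
    (s : ℝ) (hTGL : AreaInvariant.TGLAt Ω γ r s) :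
    (∃ θ₁ θ₂ : ℝ, AreaInvariant.AreCrossingAngles Ω γ s r θ₁ θ₂) ∧
    ∀ θ₁ θ₂ : ℝ, AreaInvariant.AreCrossingAngles Ω γ s r θ₁ θ₂ →
      HasDerivAt (fun ρ : ℝ => AreaInvariant.g Ω γ s ρ) (r * (θ₂ - θ₁)) r ∧
      Metric.sphere (γ s) r ∩ Ω = AreaInvariant.circlePoint γ s r '' Set.Icc θ₁ θ₂ ∧
      MeasureTheory.Measure.hausdorffMeasure 1 (Metric.sphere (γ s) r ∩ Ω) =
        ENNReal.ofReal (r * (θ₂ - θ₁)) := by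
  refine ⟨AreaInvariant.exists_areCrossingAngles hγ hr hTCGL hTGL, fun θ₁ θ₂ hθ => ?_⟩
  obtain ⟨hderiv, harc⟩ := AreaInvariant.hasDerivAt_g_and_sphere_inter_eq hγ hr hTGL hθ
  refine ⟨hderiv, harc, ?_⟩
  rw [harc]
  obtain ⟨⟨h11, h12⟩, ⟨h21, h22⟩, -⟩ := hθ
  exact AreaInvariant.hausdorffMeasure_image_circlePoint hr (hγ.unit_speed s hTGL.1)
    (by linarith) (by linarith)
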